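/- Let $(X,\mathcal B)$ be a standard Borel space, $\mathcal F(X)$ the vector space of real-valued Borel functions on $X$, and $\sigma:X\to X$ a surjective Borel map. Let $\mathcal D\subseteq\mathcal F(X)$ be a linear subspace that contains the constants and is solid (if $f\in\mathcal D$, $g\in\mathcal F(X)$ and $|g|\le|f|$, then $g\in\mathcal D$); for example $\mathcal D=\mathcal F(X)$, or $\mathcal D$ = all bounded Borel functions. Let $(R,\sigma)$ be a transfer operator, i.e. $R:\mathcal D\to\mathcal F(X)$ is linear, positive ($f\ge 0\Rightarrow R(f)\ge 0$), satisfies $R((f\circ\sigma)g)=f\,R(g)$ for all $f\in\mathcal F(X)$ and $g\in\mathcal D$ with $(f\circ\sigma)g\in\mathcal D$, and is order continuous: if $f_n\in\mathcal D$ and there are $h_n\in\mathcal D$ decreasing pointwise to $0$ with $|f_n|\le h_n$ for all large $n$, then there are $k_n\in\mathcal F(X)$ decreasing pointwise to $0$ with $|R(f_n)|\le k_n$ for all large $n$. Let $M(X)$ be the set of $\sigma$-finite Borel measures on $X$. For $\lambda\in M(X)$ let $\lambda R\in M(X)$ be the measure $(\lambda R)(A)=\int_X R(\chi_A)\,d\lambda$,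 and put $\mathcal L(R)=\{\lambda\in M(X):\lambda R\ll\lambda\}$. Let $\mathcal H(X)$ be the universal Hilbert space: its elements are the classes $f\sqrt{d\mu}$ of pairs $(f,\mu)$ with $\mu\in M(X)$ and $f\in L^2(\mu)$ real-valued, where $(f,\mu)\sim(g,\nu)$ if for some $\kappa\in M(X)$ with $\mu,\nu\ll\kappa$ one has $f\sqrt{d\mu/d\kappa}=g\sqrt{d\nu/d\kappa}$ $\kappa$-a.e. The operations are $f\sqrt{d\mu}+g\sqrt{d\nu}=\bigl(f\sqrt{d\mu/d\kappa}+g\sqrt{d\nu/d\kappa}\bigr)\sqrt{d\kappa}$ and $c\,(f\sqrt{d\mu})=(cf)\sqrt{d\mu}$, and the inner product is $\langle f\sqrt{d\mu},g\sqrt{d\nu}\rangle=\int_X fg\sqrt{d\mu/d\kappa}\sqrt{d\nu/d\kappa}\,d\kappa$, for any $\kappa\in M(X)$ with $\mu,\nu\ll\kappa$. For $\lambda\in M(X)$ let $\mathcal H(\lambda)=\{f\sqrt{d\lambda}:f\in L^2(\lambda)\}$, the image of the isometric embedding $L^2(\lambda)\to\mathcal H(X)$, $f\mapsto f\sqrt{d\lambda}$.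 Let $\widehat S$ be the (well-defined, linear) operator $$\widehat S(f\sqrt{d\lambda})=(f\circ\sigma)\sqrt{d(\lambda R)}$$ in $\mathcal H(X)$, with domain the set of all classes $f\sqrt{d\lambda}$ such that $f\circ\sigma\in L^2(\lambda R)$. Then: 1. $\widehat S$ is an isometry if and only if $R(\mathbf 1)=\mathbf 1$ (everywhere on $X$). More precisely, $\widehat S$ is isometric on its domain if and only if $R(\mathbf 1)=\mathbf 1$, and in that case its domain is all of $\mathcal H(X)$. 2. If $\lambda\in\mathcal L(R)$, then $\mathcal H(\lambda)$ is invariant under $\widehat S$: if $u\in\mathcal H(\lambda)$ lies in the domain of $\widehat S$, then $\widehat Su\in\mathcal H(\lambda)$. (Here $R(\mathbf 1)=\mathbf 1$ is not assumed.) -/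

import Mathlib

open MeasureTheory Filter Topology
open scoped ENNReal

namespace UniversalHilbert

noncomputable section

/-- The function `√(dμ/dκ)`. -/
def sqrtRN {X : Type*} [MeasurableSpace X] (μ κ : Measure X) (x : X) : ℝ :=
  Real.sqrt (μ.rnDeriv κ x).toReal

theorem measurable_sqrtRN {X : Type*} [MeasurableSpace X] (μ κ : Measure X) :
    Measurable (sqrtRN μ κ) :=
  (Measure.measurable_rnDeriv μ κ).ennreal_toReal.sqrt

theorem ae_eq_iff_mul_sqrtRN {X : Type*} [MeasurableSpace X] {μ κ : Measure X}
    [SigmaFinite μ] [SigmaFinite κ] (h : μ ≪ κ) (f g : X → ℝ) :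
    f =ᵐ[μ] g ↔ (fun x => f x * sqrtRN μ κ x) =ᵐ[κ] fun x => g x * sqrtRN μ κ x := by
  have e : f =ᵐ[μ] g ↔ f =ᵐ[κ.withDensity (μ.rnDeriv κ)] g := by
    rw [Measure.withDensity_rnDeriv_eq _ _ h]
  rw [e, Filter.EventuallyEq, ae_withDensity_iff (Measure.measurable_rnDeriv μ κ)]
  have : ∀ᵐ x ∂κ, ((μ.rnDeriv κ x ≠ 0 → f x = g x) ↔
      f x * sqrtRN μ κ x = g x * sqrtRN μ κ x) := by
    filter_upwards [Measure.rnDeriv_lt_top μ κ] with x hx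
    have : sqrtRN μ κ x = 0 ↔ μ.rnDeriv κ x = 0 := by
      rw [sqrtRN, Real.sqrt_eq_zero ENNReal.toReal_nonneg, ENNReal.toReal_eq_zero_iff]
      simp [hx.ne]
    rw [mul_eq_mul_right_iff, this]
    tauto
  constructor
  · intro h1; filter_upwards [h1, this] with x h2 h3 using h3.1 h2
  · intro h1; filter_upwards [h1, this] with x h2 h3 using h3.2 h2

theorem sqrtRN_chain {X : Type*} [MeasurableSpace X] {μ ν κ : Measure X}
    [SigmaFinite μ] [SigmaFinite ν] [SigmaFinite κ] (h : μ ≪ ν) :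
    (fun x => sqrtRN μ ν x * sqrtRN ν κ x) =ᵐ[κ] sqrtRN μ κ := by
  filter_upwards [Measure.rnDeriv_mul_rnDeriv (κ := κ) h] with x hx
  simp only [sqrtRN, ← hx, Pi.mul_apply, ENNReal.toReal_mul]
  rw [Real.sqrt_mul ENNReal.toReal_nonneg]

theorem sqrtRN_self {X : Type*} [MeasurableSpace X] (μ : Measure X) [SigmaFinite μ] :
    sqrtRN μ μ =ᵐ[μ] fun _ => 1 := by
  filter_upwards [Measure.rnDeriv_self μ] with x hx
  simp [sqrtRN, hx]

theorem integral_mul_sqrtRN {X : Type*} [MeasurableSpace X] {μ κ : Measure X}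
    [SigmaFinite μ] [SigmaFinite κ] (h : μ ≪ κ) (f g : X → ℝ) :
    ∫ x, (f x * sqrtRN μ κ x) * (g x * sqrtRN μ κ x) ∂κ = ∫ x, f x * g x ∂μ := by
  rw [← integral_rnDeriv_smul h]
  congr 1
  ext x
  have : sqrtRN μ κ x * sqrtRN μ κ x = (μ.rnDeriv κ x).toReal :=
    Real.mul_self_sqrt ENNReal.toReal_nonneg
  rw [smul_eq_mul, ← this]; ring

theorem aesm_mul_sqrtRN {X : Type*} [MeasurableSpace X] {μ κ : Measure X}
    [SigmaFinite μ] [SigmaFinite κ] (h : μ ≪ κ) {f : X → ℝ} (hf : AEStronglyMeasurable f μ) :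
    AEStronglyMeasurable (fun x => f x * sqrtRN μ κ x) κ :=
  ⟨fun x => hf.mk f x * sqrtRN μ κ x,
    hf.stronglyMeasurable_mk.mul (measurable_sqrtRN μ κ).stronglyMeasurable,
    (ae_eq_iff_mul_sqrtRN h _ _).1 hf.ae_eq_mk⟩

theorem memLp_mul_sqrtRN_iff {X : Type*} [MeasurableSpace X] {μ κ : Measure X}
    [SigmaFinite μ] [SigmaFinite κ] (h : μ ≪ κ) {f : X → ℝ} (hf : AEStronglyMeasurable f μ) :
    MemLp (fun x => f x * sqrtRN μ κ x) 2 κ ↔ MemLp f 2 μ := by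
  rw [memLp_two_iff_integrable_sq (aesm_mul_sqrtRN h hf), memLp_two_iff_integrable_sq hf,
    ← integrable_rnDeriv_smul_iff h]
  refine integrable_congr (Eventually.of_forall fun x => ?_)
  have : sqrtRN μ κ x * sqrtRN μ κ x = (μ.rnDeriv κ x).toReal :=
    Real.mul_self_sqrt ENNReal.toReal_nonneg
  simp only [smul_eq_mul]
  rw [← this]; ring

theorem memLp_mul_sqrtRN {X : Type*} [MeasurableSpace X] {μ κ : Measure X}
    [SigmaFinite μ] [SigmaFinite κ] (h : μ ≪ κ) {f : X → ℝ} (hf : MemLp f 2 μ) :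
    MemLp (fun x => f x * sqrtRN μ κ x) 2 κ :=
  (memLp_mul_sqrtRN_iff h hf.1).2 hf

/-- A pair `(f, μ)`: a σ-finite measure `μ` and a real function `f ∈ L²(μ)`. -/
structure Pair (X : Type*) [MeasurableSpace X] where
  μ : Measure X
  sigmaFinite : SigmaFinite μ
  f : X → ℝ
  memLp : MemLp f 2 μ

attribute [instance] Pair.sigmaFinite

/-- `(f, μ)` and `(g, ν)` are equivalent if `f √(dμ/dκ) = g √(dν/dκ)` holds `κ`-a.e.
for some σ-finite measure `κ` with `μ ≪ κ` and `ν ≪ κ`. -/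
def Pair.Equiv {X : Type*} [MeasurableSpace X] (p q : Pair X) : Prop :=
  ∃ κ : Measure X, SigmaFinite κ ∧ p.μ ≪ κ ∧ q.μ ≪ κ ∧
    (fun x => p.f x * sqrtRN p.μ κ x) =ᵐ[κ] fun x => q.f x * sqrtRN q.μ κ x

theorem mul_sqrtRN_chain {X : Type*} [MeasurableSpace X] {μ κ κ' : Measure X}
    [SigmaFinite μ] [SigmaFinite κ] [SigmaFinite κ'] (h : μ ≪ κ) (f : X → ℝ) :
    (fun x => f x * sqrtRN μ κ x * sqrtRN κ κ' x) =ᵐ[κ'] fun x => f x * sqrtRN μ κ' x := by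
  filter_upwards [sqrtRN_chain (κ := κ') h] with x hx
  rw [mul_assoc, hx]

theorem equiv_change {X : Type*} [MeasurableSpace X] {μ ν κ κ' : Measure X}
    [SigmaFinite μ] [SigmaFinite ν] [SigmaFinite κ] [SigmaFinite κ']
    (hμ : μ ≪ κ) (hν : ν ≪ κ) (h : κ ≪ κ') (f g : X → ℝ) :
    ((fun x => f x * sqrtRN μ κ x) =ᵐ[κ] fun x => g x * sqrtRN ν κ x) ↔
      ((fun x => f x * sqrtRN μ κ' x) =ᵐ[κ'] fun x => g x * sqrtRN ν κ' x) := by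
  rw [ae_eq_iff_mul_sqrtRN h]
  constructor
  · intro H
    exact (mul_sqrtRN_chain hμ f).symm.trans (H.trans (mul_sqrtRN_chain hν g))
  · intro H
    exact (mul_sqrtRN_chain hμ f).trans (H.trans (mul_sqrtRN_chain hν g).symm)

theorem Pair.equiv_iff {X : Type*} [MeasurableSpace X] (p q : Pair X) (κ : Measure X)
    [SigmaFinite κ] (hp : p.μ ≪ κ) (hq : q.μ ≪ κ) :
    p.Equiv q ↔ (fun x => p.f x * sqrtRN p.μ κ x) =ᵐ[κ] fun x => q.f x * sqrtRN q.μ κ x := by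
  constructor
  · rintro ⟨κ', _, hp', hq', H⟩
    have h1 : κ ≪ κ + κ' := Measure.AbsolutelyContinuous.rfl.add_right _
    have h2 : κ' ≪ κ + κ' := by
      rw [add_comm]; exact Measure.AbsolutelyContinuous.rfl.add_right _
    exact (equiv_change hp hq h1 _ _).2 ((equiv_change hp' hq' h2 _ _).1 H)
  · intro H; exact ⟨κ, inferInstance, hp, hq, H⟩

theorem ac_left {X : Type*} [MeasurableSpace X] (μ ν : Measure X) : μ ≪ μ + ν :=
  Measure.AbsolutelyContinuous.rfl.add_right _

theorem ac_right {X : Type*} [MeasurableSpace X] (μ ν : Measure X) : ν ≪ μ + ν := by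
  rw [add_comm]; exact ac_left _ _

instance Pair.setoid (X : Type*) [MeasurableSpace X] : Setoid (Pair X) where
  r := Pair.Equiv
  iseqv :=
    { refl := fun p => ⟨p.μ, inferInstance, Measure.AbsolutelyContinuous.rfl,
        Measure.AbsolutelyContinuous.rfl, EventuallyEq.rfl⟩
      symm := fun ⟨κ, h, hp, hq, H⟩ => ⟨κ, h, hq, hp, H.symm⟩
      trans := fun {p q r} h1 h2 => by
        have a1 : p.μ ≪ p.μ + q.μ + r.μ := (ac_left _ _).trans (ac_left _ _)
        have a2 : q.μ ≪ p.μ + q.μ + r.μ := (ac_right _ _).trans (ac_left _ _)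
        have a3 : r.μ ≪ p.μ + q.μ + r.μ := ac_right _ _
        rw [Pair.equiv_iff _ _ _ a1 a2] at h1
        rw [Pair.equiv_iff _ _ _ a2 a3] at h2
        rw [Pair.equiv_iff _ _ _ a1 a3]
        exact h1.trans h2 }

/-- The universal Hilbert space `ℋ(X)`: the set of classes `f √dμ` of pairs `(f, μ)`. -/
def UHilbert (X : Type*) [MeasurableSpace X] : Type _ := Quotient (Pair.setoid X)

/-- The class `f √dμ` of the pair `(f, μ)`. -/
def cls {X : Type*} [MeasurableSpace X] (f : X → ℝ) (μ : Measure X) [SigmaFinite μ]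
    (hf : MemLp f 2 μ) : UHilbert X :=
  Quotient.mk (Pair.setoid X) ⟨μ, inferInstance, f, hf⟩

theorem cls_change {X : Type*} [MeasurableSpace X] {μ κ : Measure X} [SigmaFinite μ]
    [SigmaFinite κ] (h : μ ≪ κ) {f : X → ℝ} (hf : MemLp f 2 μ) :
    cls f μ hf = cls (fun x => f x * sqrtRN μ κ x) κ (memLp_mul_sqrtRN h hf) := by
  refine Quotient.sound ?_
  refine (Pair.equiv_iff _ _ κ h Measure.AbsolutelyContinuous.rfl).2 ?_
  filter_upwards [sqrtRN_self κ] with x hx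
  simp [hx]

theorem cls_eq_iff {X : Type*} [MeasurableSpace X] {μ : Measure X} [SigmaFinite μ]
    {f g : X → ℝ} (hf : MemLp f 2 μ) (hg : MemLp g 2 μ) :
    cls f μ hf = cls g μ hg ↔ f =ᵐ[μ] g := by
  refine (Quotient.eq (r := Pair.setoid X)).trans ?_
  refine (Pair.equiv_iff _ _ μ Measure.AbsolutelyContinuous.rfl
    Measure.AbsolutelyContinuous.rfl).trans ?_
  exact (ae_eq_iff_mul_sqrtRN Measure.AbsolutelyContinuous.rfl f g).symm

theorem exists_cls {X : Type*} [MeasurableSpace X] (u : UHilbert X) :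
    ∃ (μ : Measure X) (_ : SigmaFinite μ), ∀ (κ : Measure X) [SigmaFinite κ], μ ≪ κ →
      ∃ (f : X → ℝ) (hf : MemLp f 2 κ), u = cls f κ hf := by
  induction u using Quotient.inductionOn with
  | h p => exact ⟨p.μ, p.sigmaFinite, fun κ _ h => ⟨_, _, cls_change h p.memLp⟩⟩

theorem exists_cls₂ {X : Type*} [MeasurableSpace X] (u v : UHilbert X) :
    ∃ (κ : Measure X) (_ : SigmaFinite κ) (f g : X → ℝ) (hf : MemLp f 2 κ) (hg : MemLp g 2 κ),
      u = cls f κ hf ∧ v = cls g κ hg := by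
  obtain ⟨μ, _, hu⟩ := exists_cls u
  obtain ⟨ν, _, hv⟩ := exists_cls v
  obtain ⟨f, hf, rfl⟩ := hu _ (ac_left μ ν)
  obtain ⟨g, hg, rfl⟩ := hv _ (ac_right μ ν)
  exact ⟨μ + ν, inferInstance, f, g, hf, hg, rfl, rfl⟩

theorem exists_cls₃ {X : Type*} [MeasurableSpace X] (u v w : UHilbert X) :
    ∃ (κ : Measure X) (_ : SigmaFinite κ) (f g h : X → ℝ) (hf : MemLp f 2 κ) (hg : MemLp g 2 κ)
      (hh : MemLp h 2 κ), u = cls f κ hf ∧ v = cls g κ hg ∧ w = cls h κ hh := by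
  obtain ⟨μ, _, hu⟩ := exists_cls u
  obtain ⟨ν, _, hv⟩ := exists_cls v
  obtain ⟨ρ, _, hw⟩ := exists_cls w
  obtain ⟨f, hf, rfl⟩ := hu (μ + ν + ρ) ((ac_left _ _).trans (ac_left _ _))
  obtain ⟨g, hg, rfl⟩ := hv (μ + ν + ρ) ((ac_right _ _).trans (ac_left _ _))
  obtain ⟨h, hh, rfl⟩ := hw (μ + ν + ρ) (ac_right _ _)
  exact ⟨_, inferInstance, f, g, h, hf, hg, hh, rfl, rfl, rfl⟩

/-- The sum of two pairs, computed with the dominating measure `μ + ν`. -/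
def Pair.add {X : Type*} [MeasurableSpace X] (p q : Pair X) : UHilbert X :=
  cls (fun x => p.f x * sqrtRN p.μ (p.μ + q.μ) x + q.f x * sqrtRN q.μ (p.μ + q.μ) x) (p.μ + q.μ)
    ((memLp_mul_sqrtRN (ac_left _ _) p.memLp).add (memLp_mul_sqrtRN (ac_right _ _) q.memLp))

theorem Pair.add_eq {X : Type*} [MeasurableSpace X] (p q : Pair X) (κ : Measure X)
    [SigmaFinite κ] (hp : p.μ ≪ κ) (hq : q.μ ≪ κ) :
    p.add q = cls (fun x => p.f x * sqrtRN p.μ κ x + q.f x * sqrtRN q.μ κ x) κ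
      ((memLp_mul_sqrtRN hp p.memLp).add (memLp_mul_sqrtRN hq q.memLp)) := by
  have h : p.μ + q.μ ≪ κ := Measure.AbsolutelyContinuous.add_left hp hq
  rw [Pair.add, cls_change h, cls_eq_iff]
  filter_upwards [mul_sqrtRN_chain (κ' := κ) (ac_left p.μ q.μ) p.f,
    mul_sqrtRN_chain (κ' := κ) (ac_right p.μ q.μ) q.f] with x h1 h2
  rw [add_mul, h1, h2]

/-- The inner product of two pairs, computed with the dominating measure `μ + ν`. -/
def Pair.inner {X : Type*} [MeasurableSpace X] (p q : Pair X) : ℝ :=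
  ∫ x, p.f x * q.f x * sqrtRN p.μ (p.μ + q.μ) x * sqrtRN q.μ (p.μ + q.μ) x ∂(p.μ + q.μ)

theorem Pair.inner_eq {X : Type*} [MeasurableSpace X] (p q : Pair X) (κ : Measure X)
    [SigmaFinite κ] (hp : p.μ ≪ κ) (hq : q.μ ≪ κ) :
    p.inner q = ∫ x, (p.f x * sqrtRN p.μ κ x) * (q.f x * sqrtRN q.μ κ x) ∂κ := by
  have h : p.μ + q.μ ≪ κ := Measure.AbsolutelyContinuous.add_left hp hq
  have e : p.inner q = ∫ x, (p.f x * sqrtRN p.μ (p.μ + q.μ) x) *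
      (q.f x * sqrtRN q.μ (p.μ + q.μ) x) ∂(p.μ + q.μ) := by
    unfold Pair.inner
    congr 1; ext x; ring
  rw [e, ← integral_mul_sqrtRN h]
  refine integral_congr_ae ?_
  filter_upwards [mul_sqrtRN_chain (κ' := κ) (ac_left p.μ q.μ) p.f,
    mul_sqrtRN_chain (κ' := κ) (ac_right p.μ q.μ) q.f] with x h1 h2
  rw [h1, h2]

theorem Pair.common {X : Type*} [MeasurableSpace X] {p q p' q' : Pair X} (hp : p.Equiv p')
    (hq : q.Equiv q') : ∃ (κ : Measure X) (_ : SigmaFinite κ), p.μ ≪ κ ∧ q.μ ≪ κ ∧ p'.μ ≪ κ ∧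
      q'.μ ≪ κ ∧
      ((fun x => p.f x * sqrtRN p.μ κ x) =ᵐ[κ] fun x => p'.f x * sqrtRN p'.μ κ x) ∧
      ((fun x => q.f x * sqrtRN q.μ κ x) =ᵐ[κ] fun x => q'.f x * sqrtRN q'.μ κ x) := by
  have a1 : p.μ ≪ (p.μ + q.μ) + (p'.μ + q'.μ) := (ac_left _ _).trans (ac_left _ _)
  have a2 : q.μ ≪ (p.μ + q.μ) + (p'.μ + q'.μ) := (ac_right _ _).trans (ac_left _ _)
  have a3 : p'.μ ≪ (p.μ + q.μ) + (p'.μ + q'.μ) := (ac_left _ _).trans (ac_right _ _)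
  have a4 : q'.μ ≪ (p.μ + q.μ) + (p'.μ + q'.μ) := (ac_right _ _).trans (ac_right _ _)
  exact ⟨_, inferInstance, a1, a2, a3, a4, (Pair.equiv_iff _ _ _ a1 a3).1 hp,
    (Pair.equiv_iff _ _ _ a2 a4).1 hq⟩

instance {X : Type*} [MeasurableSpace X] : Add (UHilbert X) where
  add := Quotient.lift₂ Pair.add (by
    intro p q p' q' hp hq
    obtain ⟨κ, _, a1, a2, a3, a4, e1, e2⟩ := Pair.common hp hq
    rw [Pair.add_eq p q κ a1 a2, Pair.add_eq p' q' κ a3 a4, cls_eq_iff]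
    filter_upwards [e1, e2] with x h1 h2
    rw [h1, h2])

instance {X : Type*} [MeasurableSpace X] : Inner ℝ (UHilbert X) where
  inner := Quotient.lift₂ Pair.inner (by
    intro p q p' q' hp hq
    obtain ⟨κ, _, a1, a2, a3, a4, e1, e2⟩ := Pair.common hp hq
    rw [Pair.inner_eq p q κ a1 a2, Pair.inner_eq p' q' κ a3 a4]
    refine integral_congr_ae ?_
    filter_upwards [e1, e2] with x h1 h2
    rw [h1, h2])

instance {X : Type*} [MeasurableSpace X] : SMul ℝ (UHilbert X) where
  smul c := Quotient.lift (fun p : Pair X => cls (fun x => c * p.f x) p.μ (p.memLp.const_mul c)) (by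
    intro p q hp
    have a1 := ac_left p.μ q.μ
    have a2 := ac_right p.μ q.μ
    have e := (Pair.equiv_iff _ _ _ a1 a2).1 hp
    rw [cls_change a1, cls_change a2, cls_eq_iff]
    filter_upwards [e] with x h
    rw [mul_assoc, h, mul_assoc])

instance {X : Type*} [MeasurableSpace X] : Zero (UHilbert X) where
  zero := cls (fun _ => 0) 0 MemLp.zero'

instance {X : Type*} [MeasurableSpace X] : Neg (UHilbert X) where
  neg u := (-1 : ℝ) • u

theorem cls_add {X : Type*} [MeasurableSpace X] {μ : Measure X} [SigmaFinite μ]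
    {f g : X → ℝ} (hf : MemLp f 2 μ) (hg : MemLp g 2 μ) :
    cls f μ hf + cls g μ hg = cls (fun x => f x + g x) μ (hf.add hg) := by
  refine (Pair.add_eq ⟨μ, inferInstance, f, hf⟩ ⟨μ, inferInstance, g, hg⟩ μ
    Measure.AbsolutelyContinuous.rfl Measure.AbsolutelyContinuous.rfl).trans ?_
  rw [cls_eq_iff]
  filter_upwards [sqrtRN_self μ] with x hx
  simp [hx]

theorem cls_smul {X : Type*} [MeasurableSpace X] {μ : Measure X} [SigmaFinite μ] (c : ℝ)
    {f : X → ℝ} (hf : MemLp f 2 μ) :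
    c • cls f μ hf = cls (fun x => c * f x) μ (hf.const_mul c) := rfl

theorem cls_neg {X : Type*} [MeasurableSpace X] {μ : Measure X} [SigmaFinite μ]
    {f : X → ℝ} (hf : MemLp f 2 μ) :
    -cls f μ hf = cls (fun x => (-1) * f x) μ (hf.const_mul (-1)) := rfl

theorem zero_eq_cls {X : Type*} [MeasurableSpace X] (μ : Measure X) [SigmaFinite μ] :
    (0 : UHilbert X) = cls (fun _ => 0) μ MemLp.zero' := by
  refine (cls_change (Measure.AbsolutelyContinuous.zero μ) MemLp.zero').trans ?_
  rw [cls_eq_iff]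
  simp

theorem cls_inner {X : Type*} [MeasurableSpace X] {μ : Measure X} [SigmaFinite μ]
    {f g : X → ℝ} (hf : MemLp f 2 μ) (hg : MemLp g 2 μ) :
    inner ℝ (cls f μ hf) (cls g μ hg) = ∫ x, f x * g x ∂μ := by
  refine (Pair.inner_eq ⟨μ, inferInstance, f, hf⟩ ⟨μ, inferInstance, g, hg⟩ μ
    Measure.AbsolutelyContinuous.rfl Measure.AbsolutelyContinuous.rfl).trans ?_
  exact integral_mul_sqrtRN Measure.AbsolutelyContinuous.rfl f g

instance {X : Type*} [MeasurableSpace X] : AddCommGroup (UHilbert X) where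
  add_assoc u v w := by
    obtain ⟨κ, _, f, g, h, hf, hg, hh, rfl, rfl, rfl⟩ := exists_cls₃ u v w
    simp only [cls_add, add_assoc]
  zero_add u := by
    obtain ⟨κ, _, f, g, hf, hg, rfl, -⟩ := exists_cls₂ u u
    rw [zero_eq_cls κ, cls_add]; simp only [zero_add]
  add_zero u := by
    obtain ⟨κ, _, f, g, hf, hg, rfl, -⟩ := exists_cls₂ u u
    rw [zero_eq_cls κ, cls_add]; simp only [add_zero]
  nsmul := nsmulRec
  zsmul := zsmulRec
  neg_add_cancel u := by
    obtain ⟨κ, _, f, g, hf, hg, rfl, -⟩ := exists_cls₂ u u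
    rw [zero_eq_cls κ, cls_neg, cls_add, cls_eq_iff]
    exact Eventually.of_forall fun x => by ring
  add_comm u v := by
    obtain ⟨κ, _, f, g, hf, hg, rfl, rfl⟩ := exists_cls₂ u v
    simp only [cls_add, add_comm]

instance {X : Type*} [MeasurableSpace X] : Module ℝ (UHilbert X) where
  one_smul u := by
    obtain ⟨κ, _, f, g, hf, hg, rfl, -⟩ := exists_cls₂ u u
    simp only [cls_smul, one_mul]
  mul_smul a b u := by
    obtain ⟨κ, _, f, g, hf, hg, rfl, -⟩ := exists_cls₂ u u
    simp only [cls_smul, mul_assoc]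
  smul_zero a := by
    rw [zero_eq_cls 0]; simp only [cls_smul, mul_zero]
  smul_add a u v := by
    obtain ⟨κ, _, f, g, hf, hg, rfl, rfl⟩ := exists_cls₂ u v
    simp only [cls_add, cls_smul, mul_add]
  add_smul a b u := by
    obtain ⟨κ, _, f, g, hf, hg, rfl, -⟩ := exists_cls₂ u u
    simp only [cls_add, cls_smul, add_mul]
  zero_smul u := by
    obtain ⟨κ, _, f, g, hf, hg, rfl, -⟩ := exists_cls₂ u u
    rw [zero_eq_cls κ]; simp only [cls_smul, zero_mul]

abbrev innerCore (X : Type*) [MeasurableSpace X] : InnerProductSpace.Core ℝ (UHilbert X) where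
  toInner := inferInstance
  conj_inner_symm u v := by
    obtain ⟨κ, _, f, g, hf, hg, rfl, rfl⟩ := exists_cls₂ u v
    simp only [cls_inner, mul_comm, conj_trivial]
  re_inner_nonneg u := by
    obtain ⟨κ, _, f, g, hf, hg, rfl, -⟩ := exists_cls₂ u u
    rw [cls_inner]
    exact integral_nonneg fun x => mul_self_nonneg (f x)
  add_left u v w := by
    obtain ⟨κ, _, f, g, h, hf, hg, hh, rfl, rfl, rfl⟩ := exists_cls₃ u v w
    simp only [cls_add, cls_inner, add_mul]
    exact integral_add (hf.integrable_mul hh) (hg.integrable_mul hh)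
  smul_left u v r := by
    obtain ⟨κ, _, f, g, hf, hg, rfl, rfl⟩ := exists_cls₂ u v
    simp only [cls_smul, cls_inner, mul_assoc, conj_trivial]
    exact integral_const_mul _ _
  definite u hu := by
    obtain ⟨κ, _, f, g, hf, hg, rfl, -⟩ := exists_cls₂ u u
    rw [cls_inner, integral_eq_zero_iff_of_nonneg (fun x => mul_self_nonneg (f x))
      (hf.integrable_mul hf)] at hu
    rw [zero_eq_cls κ, cls_eq_iff]
    filter_upwards [hu] with x hx
    simpa using hx

instance {X : Type*} [MeasurableSpace X] : NormedAddCommGroup (UHilbert X) :=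
  @InnerProductSpace.Core.toNormedAddCommGroup ℝ (UHilbert X) _ _ _ (innerCore X)

instance {X : Type*} [MeasurableSpace X] : InnerProductSpace ℝ (UHilbert X) :=
  InnerProductSpace.ofCore (innerCore X).toCore

/-- The isometric embedding `ι : f ↦ f √dμ` of `L²(μ)` into `ℋ(X)`. -/
def iota {X : Type*} [MeasurableSpace X] (μ : Measure X) [SigmaFinite μ] :
    Lp ℝ 2 μ →ₗᵢ[ℝ] UHilbert X where
  toFun f := cls f μ (Lp.memLp f)
  map_add' f g := by
    rw [cls_add, cls_eq_iff]
    exact Lp.coeFn_add f g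
  map_smul' c f := by
    rw [RingHom.id_apply, cls_smul, cls_eq_iff]
    exact Lp.coeFn_smul c f
  norm_map' f := by
    have h : inner ℝ (cls f μ (Lp.memLp f)) (cls f μ (Lp.memLp f)) = inner ℝ f f := by
      rw [cls_inner, L2.inner_def]
      rfl
    rw [real_inner_self_eq_norm_sq, real_inner_self_eq_norm_sq] at h
    exact (sq_eq_sq₀ (norm_nonneg _) (norm_nonneg _)).1 h

/-- The subspace `ℋ(μ) = ι(L²(μ))` of `ℋ(X)`. -/
def subspaceOf {X : Type*} [MeasurableSpace X] (μ : Measure X) [SigmaFinite μ] : Submodule ℝ (UHilbert X) :=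
  LinearMap.range (iota μ).toLinearMap

theorem cls_mem_subspaceOf {X : Type*} [MeasurableSpace X] {μ : Measure X} [SigmaFinite μ]
    {f : X → ℝ} (hf : MemLp f 2 μ) : cls f μ hf ∈ subspaceOf μ :=
  ⟨hf.toLp f, (cls_eq_iff _ hf).2 hf.coeFn_toLp⟩

instance {X : Type*} [MeasurableSpace X] : CompleteSpace (UHilbert X) := by
  refine Metric.complete_of_cauchySeq_tendsto fun u hu => ?_
  choose μ hμ h using fun n => exists_cls (u n)
  let κ : Measure X := (Measure.sum μ).toFinite
  have hk : ∀ n, ∃ f : Lp ℝ 2 κ, iota κ f = u n := fun n => by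
    obtain ⟨f, hf, e⟩ := h n κ ((Measure.absolutelyContinuous_sum_right n
      Measure.AbsolutelyContinuous.rfl).trans (absolutelyContinuous_toFinite _))
    rw [e]; exact cls_mem_subspaceOf hf
  choose f hf using hk
  have hc : CauchySeq f := by
    rw [Metric.cauchySeq_iff] at hu ⊢
    intro ε hε
    obtain ⟨N, hN⟩ := hu ε hε
    refine ⟨N, fun m hm n hn => ?_⟩
    rw [← (iota κ).dist_map, hf, hf]
    exact hN m hm n hn
  obtain ⟨g, hg⟩ := cauchySeq_tendsto_of_complete hc
  refine ⟨iota κ g, ?_⟩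
  have := ((iota κ).continuous.tendsto g).comp hg
  convert this using 1
  exact (funext hf).symm

/-- A sequence `f` of functions order converges to `0` in the space `E` of functions: there are
`h n ∈ E` decreasing to `0` with `|f n| ≤ h n` for all large `n`. (In the spaces used below the
infimum of a decreasing sequence in `E` that is bounded below by `0` is the pointwise one.) -/
def OrderNull {X : Type*} (E : Submodule ℝ (X → ℝ)) (f : ℕ → X → ℝ) : Prop :=
  ∃ h : ℕ → X → ℝ, (∀ n, h n ∈ E) ∧ Antitone h ∧
    (∀ x, Tendsto (fun n => h n x) atTop (𝓝 0)) ∧ ∀ᶠ n in atTop, ∀ x, |f n x| ≤ h n x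

/-- The space `𝓕(X)` of all real-valued Borel functions. -/
def borelFun (X : Type*) [MeasurableSpace X] : Submodule ℝ (X → ℝ) where
  carrier := {f | Measurable f}
  add_mem' hf hg := Measurable.add hf hg
  zero_mem' := measurable_const
  smul_mem' c _ hf := Measurable.const_mul hf c

/-- An order continuous transfer operator `(R, σ)`. Its domain `dom` is a space of Borel functions
that contains the constants and, with `f`, all Borel `g` with `|g| ≤ |f|`: for instance
the space of all Borel functions, or the space of all bounded ones. -/
structure TransferOperator (X : Type*) [MeasurableSpace X] where
  /-- the surjective Borel endomorphism -/
  σ : X → X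
  measurable_σ : Measurable σ
  surjective_σ : Function.Surjective σ
  /-- the space of functions on which `R` acts -/
  dom : Submodule ℝ (X → ℝ)
  dom_le : dom ≤ borelFun X
  one_mem : (1 : X → ℝ) ∈ dom
  solid : ∀ f ∈ dom, ∀ g ∈ borelFun X, (∀ x, |g x| ≤ |f x|) → g ∈ dom
  /-- the operator -/
  R : dom →ₗ[ℝ] borelFun X
  /-- `R` is positive -/
  nonneg : ∀ f : dom, (∀ x, 0 ≤ f.1 x) → ∀ x, 0 ≤ (R f).1 x
  /-- the pull-out property `R ((f ∘ σ) g) = f R(g)` -/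
  pull_out : ∀ f ∈ borelFun X, ∀ (g : dom) (h : (f ∘ σ) * g.1 ∈ dom),
    (R ⟨(f ∘ σ) * g.1, h⟩).1 = f * (R g).1
  /-- `R` is order continuous -/
  order_cont : ∀ f : ℕ → dom, OrderNull dom (fun n => (f n).1) →
    OrderNull (borelFun X) (fun n => (R (f n)).1)

namespace TransferOperator

/-- The constant function `1`, as an element of the domain of `R`. -/
def one {X : Type*} [MeasurableSpace X] (T : TransferOperator X) : T.dom := ⟨1, T.one_mem⟩

/-- The characteristic function of a Borel set, as an element of the domain of `R`. -/
def chi {X : Type*} [MeasurableSpace X] (T : TransferOperator X) (A : Set X)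
    (hA : MeasurableSet A) : T.dom :=
  ⟨A.indicator 1, T.solid 1 T.one_mem _ (measurable_one.indicator hA) fun x => by
    by_cases h : x ∈ A <;> simp [h]⟩

theorem chi_val {X : Type*} [MeasurableSpace X] (T : TransferOperator X) {A : Set X}
    (hA : MeasurableSet A) : (T.chi A hA).1 = A.indicator 1 := rfl

theorem R_chi_nonneg {X : Type*} [MeasurableSpace X] (T : TransferOperator X) {A : Set X}
    (hA : MeasurableSet A) (x : X) : 0 ≤ (T.R (T.chi A hA)).1 x :=
  T.nonneg _ (fun y => by rw [chi_val]; exact Set.indicator_nonneg (fun _ _ => zero_le_one) y) x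

theorem R_chi_union {X : Type*} [MeasurableSpace X] (T : TransferOperator X) {A B : Set X}
    (hA : MeasurableSet A) (hB : MeasurableSet B) (h : Disjoint A B) :
    T.R (T.chi (A ∪ B) (hA.union hB)) = T.R (T.chi A hA) + T.R (T.chi B hB) := by
  rw [← map_add]
  congr 1
  apply Subtype.ext
  change (A ∪ B).indicator (1 : X → ℝ) = A.indicator 1 + B.indicator 1
  exact Set.indicator_union_of_disjoint h 1

theorem R_chi_iUnion {X : Type*} [MeasurableSpace X] (T : TransferOperator X) {A : ℕ → Set X}
    (hA : ∀ i, MeasurableSet (A i)) (hd : Pairwise (Function.onFun Disjoint A)) (x : X) :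
    ENNReal.ofReal ((T.R (T.chi (⋃ i, A i) (MeasurableSet.iUnion hA))).1 x) =
      ∑' i, ENNReal.ofReal ((T.R (T.chi (A i) (hA i))).1 x) := by
  let U : ℕ → Set X := fun n => ⋃ i ∈ Finset.range n, A i
  have hU : ∀ n, MeasurableSet (U n) := fun n => Finset.measurableSet_biUnion _ fun i _ => hA i
  let V : ℕ → Set X := fun n => (⋃ i, A i) \ U n
  have hV : ∀ n, MeasurableSet (V n) := fun n => (MeasurableSet.iUnion hA).diff (hU n)
  have hUV : ∀ n, U n ∪ V n = ⋃ i, A i := fun n =>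
    Set.union_sdiff_cancel (Set.iUnion₂_subset fun i _ => Set.subset_iUnion A i)
  have e1 : ∀ n, (T.R (T.chi (⋃ i, A i) (MeasurableSet.iUnion hA))).1 x =
      (T.R (T.chi (U n) (hU n))).1 x + (T.R (T.chi (V n) (hV n))).1 x := fun n => by
    have := T.R_chi_union (hU n) (hV n) Set.disjoint_sdiff_right
    simp only [hUV n] at this
    rw [this]; rfl
  have e2 : ∀ n, (T.R (T.chi (U n) (hU n))).1 x =
      ∑ i ∈ Finset.range n, (T.R (T.chi (A i) (hA i))).1 x := by
    intro n
    induction n with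
    | zero =>
      have : T.chi (U 0) (hU 0) = 0 := by
        apply Subtype.ext
        rw [chi_val]
        simp only [U, Finset.range_zero, Finset.notMem_empty, Set.iUnion_of_empty, Set.iUnion_empty,
          Set.indicator_empty']
        rfl
      rw [this, map_zero]; simp
    | succ n ih =>
      have hn : U (n + 1) = U n ∪ A n := by
        simp only [U, Finset.range_add_one, Finset.set_biUnion_insert]
        exact Set.union_comm _ _
      have hdis : Disjoint (U n) (A n) := by
        simp only [U, Set.disjoint_iUnion_left]
        intro i hi
        exact hd (Finset.mem_range.1 hi).ne
      have := T.R_chi_union (hU n) (hA n) hdis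
      simp only [← hn] at this
      rw [this, Finset.sum_range_succ, ← ih]; rfl
  have hVnull : Tendsto (fun n => (T.R (T.chi (V n) (hV n))).1 x) atTop (𝓝 0) := by
    obtain ⟨h, -, -, h0, hb⟩ := T.order_cont (fun n => T.chi (V n) (hV n))
      ⟨fun n => (V n).indicator 1, fun n => (T.chi (V n) (hV n)).2, by
        intro m n hmn y
        refine Set.indicator_le_indicator_of_subset ?_ (fun _ => zero_le_one) y
        refine Set.sdiff_subset_sdiff_right ?_
        exact Set.biUnion_subset_biUnion_left fun i hi =>
          Finset.mem_range.2 ((Finset.mem_range.1 hi).trans_le hmn), by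
        intro y
        refine tendsto_const_nhds.congr' ?_
        by_cases hy : ∃ i, y ∈ A i
        · obtain ⟨i, hi⟩ := hy
          filter_upwards [eventually_gt_atTop i] with n hn
          have : y ∉ V n := fun hy => hy.2 (Set.mem_biUnion (Finset.mem_range.2 hn) hi)
          simp [this]
        · refine Eventually.of_forall fun n => ?_
          have : y ∉ V n := fun h => hy (Set.mem_iUnion.1 h.1)
          simp [this],
        Eventually.of_forall fun n y => by
          exact (abs_of_nonneg (Set.indicator_nonneg (fun _ _ => zero_le_one) y)).le⟩
    refine squeeze_zero_norm' ?_ (h0 x)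
    filter_upwards [hb] with n hn using hn x
  have hlim : Tendsto (fun n => ENNReal.ofReal (∑ i ∈ Finset.range n,
      (T.R (T.chi (A i) (hA i))).1 x)) atTop
      (𝓝 (ENNReal.ofReal ((T.R (T.chi (⋃ i, A i) (MeasurableSet.iUnion hA))).1 x))) := by
    refine (ENNReal.continuous_ofReal.tendsto _).comp ?_
    have : Tendsto (fun n => (T.R (T.chi (⋃ i, A i) (MeasurableSet.iUnion hA))).1 x -
        (T.R (T.chi (V n) (hV n))).1 x) atTop
        (𝓝 ((T.R (T.chi (⋃ i, A i) (MeasurableSet.iUnion hA))).1 x - 0)) :=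
      tendsto_const_nhds.sub hVnull
    rw [sub_zero] at this
    refine this.congr fun n => ?_
    rw [← e2, e1 n]; ring
  refine tendsto_nhds_unique hlim ?_
  have := ENNReal.tendsto_nat_tsum fun i => ENNReal.ofReal ((T.R (T.chi (A i) (hA i))).1 x)
  refine this.congr fun n => ?_
  rw [ENNReal.ofReal_sum_of_nonneg fun i _ => T.R_chi_nonneg (hA i) x]

theorem R_chi_empty {X : Type*} [MeasurableSpace X] (T : TransferOperator X) (x : X) :
    ENNReal.ofReal ((T.R (T.chi ∅ MeasurableSet.empty)).1 x) = 0 := by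
  have : T.chi ∅ MeasurableSet.empty = 0 := by
    apply Subtype.ext
    rw [chi_val, Set.indicator_empty']
    rfl
  rw [this, map_zero]
  simp

theorem measurable_R_chi {X : Type*} [MeasurableSpace X] (T : TransferOperator X) {A : Set X}
    (hA : MeasurableSet A) : Measurable fun x => ENNReal.ofReal ((T.R (T.chi A hA)).1 x) :=
  (show Measurable (T.R (T.chi A hA)).1 from (T.R (T.chi A hA)).2).ennreal_ofReal

/-- The measure `μR`, given by `(μR)(A) = ∫ R(χ_A) dμ`. -/
def act {X : Type*} [MeasurableSpace X] (T : TransferOperator X) (μ : Measure X) : Measure X :=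
  Measure.ofMeasurable (fun A hA => ∫⁻ x, ENNReal.ofReal ((T.R (T.chi A hA)).1 x) ∂μ)
    (by simp only [T.R_chi_empty]; simp)
    (fun A hA hd => by
      simp only [T.R_chi_iUnion hA hd]
      exact lintegral_tsum fun i => (T.measurable_R_chi (hA i)).aemeasurable)

/-- The finite measure `A ↦ R(χ_A)(x)`. -/
def ker {X : Type*} [MeasurableSpace X] (T : TransferOperator X) (x : X) : Measure X :=
  Measure.ofMeasurable (fun A hA => ENNReal.ofReal ((T.R (T.chi A hA)).1 x))
    (T.R_chi_empty x) (fun _ hA hd => T.R_chi_iUnion hA hd x)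

theorem ker_apply {X : Type*} [MeasurableSpace X] (T : TransferOperator X) (x : X) {A : Set X}
    (hA : MeasurableSet A) : T.ker x A = ENNReal.ofReal ((T.R (T.chi A hA)).1 x) :=
  Measure.ofMeasurable_apply A hA

theorem act_apply {X : Type*} [MeasurableSpace X] (T : TransferOperator X) (μ : Measure X)
    {A : Set X} (hA : MeasurableSet A) :
    T.act μ A = ∫⁻ x, ENNReal.ofReal ((T.R (T.chi A hA)).1 x) ∂μ :=
  Measure.ofMeasurable_apply A hA

theorem measurable_ker {X : Type*} [MeasurableSpace X] (T : TransferOperator X) :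
    Measurable T.ker :=
  Measure.measurable_of_measurable_coe _ fun A hA => by
    simp only [T.ker_apply _ hA]; exact T.measurable_R_chi hA

theorem act_eq_bind {X : Type*} [MeasurableSpace X] (T : TransferOperator X) (μ : Measure X) :
    T.act μ = μ.bind T.ker := by
  ext A hA
  rw [T.act_apply μ hA, Measure.bind_apply hA T.measurable_ker.aemeasurable]
  simp only [T.ker_apply _ hA]

theorem lintegral_act {X : Type*} [MeasurableSpace X] (T : TransferOperator X) (μ : Measure X)
    {g : X → ℝ≥0∞} (hg : Measurable g) :
    ∫⁻ y, g y ∂(T.act μ) = ∫⁻ x, ∫⁻ y, g y ∂(T.ker x) ∂μ := by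
  rw [act_eq_bind, Measure.lintegral_bind T.measurable_ker.aemeasurable hg.aemeasurable]

theorem ae_ker {X : Type*} [MeasurableSpace X] [MeasurableSingletonClass X]
    (T : TransferOperator X) (x : X) : ∀ᵐ y ∂(T.ker x), T.σ y = x := by
  have hB : MeasurableSet ({x}ᶜ : Set X) := (measurableSet_singleton x).compl
  have hA : MeasurableSet (T.σ ⁻¹' {x}ᶜ) := T.measurable_σ hB
  have e : ((({x}ᶜ : Set X).indicator (1 : X → ℝ)) ∘ T.σ) * T.one.1 =
      (T.chi (T.σ ⁻¹' {x}ᶜ) hA).1 := by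
    ext y
    rw [chi_val]
    simp only [one, mul_one]
    rfl
  have h := T.pull_out (({x}ᶜ : Set X).indicator 1) (measurable_one.indicator hB) T.one
    (by rw [e]; exact (T.chi _ hA).2)
  have h2 : (T.R (T.chi (T.σ ⁻¹' {x}ᶜ) hA)).1 x = 0 := by
    have : T.chi (T.σ ⁻¹' {x}ᶜ) hA =
        ⟨((({x}ᶜ : Set X).indicator (1 : X → ℝ)) ∘ T.σ) * T.one.1,
          by rw [e]; exact (T.chi _ hA).2⟩ := Subtype.ext e.symm
    rw [this, h]
    simp
  have h3 : T.ker x (T.σ ⁻¹' {x}ᶜ) = 0 := by rw [T.ker_apply x hA, h2, ENNReal.ofReal_zero]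
  exact h3

theorem lintegral_act_mul {X : Type*} [MeasurableSpace X] [MeasurableSingletonClass X]
    (T : TransferOperator X) (μ : Measure X)
    {φ g : X → ℝ≥0∞} (hφ : Measurable φ) (hg : Measurable g) :
    ∫⁻ y, φ (T.σ y) * g y ∂(T.act μ) = ∫⁻ x, φ x * ∫⁻ y, g y ∂(T.ker x) ∂μ := by
  refine (T.lintegral_act μ ((hφ.comp T.measurable_σ).mul hg)).trans ?_
  refine lintegral_congr fun x => ?_
  rw [← lintegral_const_mul _ hg]
  refine lintegral_congr_ae ?_
  filter_upwards [T.ae_ker x] with y hy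
  simp only [Pi.mul_apply, Function.comp_apply, hy]

theorem act_withDensity {X : Type*} [MeasurableSpace X] [MeasurableSingletonClass X]
    (T : TransferOperator X) (μ : Measure X) {φ : X → ℝ≥0∞} (hφ : Measurable φ) :
    T.act (μ.withDensity φ) = (T.act μ).withDensity (φ ∘ T.σ) := by
  ext A hA
  have hk : Measurable fun x => T.ker x A := (Measure.measurable_coe hA).comp T.measurable_ker
  have h := T.lintegral_act_mul μ hφ (measurable_one.indicator hA : Measurable (A.indicator 1))
  simp only [lintegral_indicator_one hA] at h
  rw [withDensity_apply _ hA, act_eq_bind, Measure.bind_apply hA T.measurable_ker.aemeasurable,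
    lintegral_withDensity_eq_lintegral_mul _ hφ hk]
  refine h.symm.trans ?_
  rw [← lintegral_indicator hA]
  refine lintegral_congr fun y => ?_
  by_cases hy : y ∈ A <;> simp [hy]

theorem quasi {X : Type*} [MeasurableSpace X] [MeasurableSingletonClass X]
    (T : TransferOperator X) (μ : Measure X) :
    Measure.QuasiMeasurePreserving T.σ (T.act μ) μ := by
  refine ⟨T.measurable_σ, Measure.AbsolutelyContinuous.mk fun B hB h0 => ?_⟩
  rw [Measure.map_apply T.measurable_σ hB]
  have h := T.lintegral_act_mul μ (φ := B.indicator 1) (g := fun _ => 1)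
    (measurable_one.indicator hB) measurable_const
  have e : ∫⁻ y, (B.indicator 1 (T.σ y) : ℝ≥0∞) * 1 ∂(T.act μ) = T.act μ (T.σ ⁻¹' B) := by
    rw [← lintegral_indicator_one (T.measurable_σ hB)]
    refine lintegral_congr fun y => ?_
    rw [mul_one]; rfl
  rw [← e, h]
  refine (lintegral_congr_ae (g := fun _ => 0) ?_).trans (by simp)
  filter_upwards [measure_eq_zero_iff_ae_notMem.1 h0] with x hx
  simp [hx]

theorem act_mono_ac {X : Type*} [MeasurableSpace X] (T : TransferOperator X) {μ ν : Measure X}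
    (h : μ ≪ ν) : T.act μ ≪ T.act ν := by
  refine Measure.AbsolutelyContinuous.mk fun A hA h0 => ?_
  rw [T.act_apply _ hA] at h0 ⊢
  rw [lintegral_eq_zero_iff (T.measurable_R_chi hA)] at h0 ⊢
  exact h.ae_le h0

instance {X : Type*} [MeasurableSpace X] [MeasurableSingletonClass X]
    (T : TransferOperator X) (μ : Measure X) [SigmaFinite μ] : SigmaFinite (T.act μ) := by
  have hm : Measurable (T.R T.one).1 := (T.R T.one).2
  let B : ℕ → Set X := fun n => {x | (T.R T.one).1 x ≤ n} ∩ spanningSets μ n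
  have hB : ∀ n, MeasurableSet (B n) := fun n =>
    (measurableSet_le hm measurable_const).inter (measurableSet_spanningSets μ n)
  refine ⟨⟨⟨fun n => T.σ ⁻¹' (B n), fun _ => trivial, fun n => ?_, ?_⟩⟩⟩
  · have h := T.lintegral_act_mul μ (φ := (B n).indicator 1) (g := fun _ => 1)
      (measurable_one.indicator (hB n)) measurable_const
    have e : ∫⁻ y, ((B n).indicator 1 (T.σ y) : ℝ≥0∞) * 1 ∂(T.act μ) =
        T.act μ (T.σ ⁻¹' (B n)) := by
      rw [← lintegral_indicator_one (T.measurable_σ (hB n))]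
      refine lintegral_congr fun y => ?_
      rw [mul_one]; rfl
    have hu : T.chi Set.univ MeasurableSet.univ = T.one :=
      Subtype.ext (by rw [chi_val]; simp [one])
    rw [← e, h]
    calc ∫⁻ x, (B n).indicator 1 x * ∫⁻ _, 1 ∂(T.ker x) ∂μ
        ≤ ∫⁻ x, (spanningSets μ n).indicator (fun _ => (n : ℝ≥0∞)) x ∂μ := by
          refine lintegral_mono fun x => ?_
          by_cases hx : x ∈ B n
          · simp only [Set.indicator_of_mem hx, Set.indicator_of_mem hx.2, Pi.one_apply, one_mul,
              lintegral_const]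
            rw [T.ker_apply x MeasurableSet.univ, hu]
            exact ENNReal.ofReal_le_of_le_toReal (by simpa using hx.1)
          · simp [hx]
      _ < ∞ := by
          rw [lintegral_indicator_const (measurableSet_spanningSets μ n)]
          exact ENNReal.mul_lt_top (ENNReal.natCast_lt_top n) (measure_spanningSets_lt_top μ n)
  · rw [← Set.preimage_iUnion, ← Set.preimage_univ (f := T.σ)]
    congr 1
    refine Set.eq_univ_of_forall fun x => ?_
    obtain ⟨m, hm⟩ := exists_nat_ge ((T.R T.one).1 x)
    have hx : x ∈ ⋃ n, spanningSets μ n := by rw [iUnion_spanningSets]; trivial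
    obtain ⟨k, hk⟩ := Set.mem_iUnion.1 hx
    refine Set.mem_iUnion.2 ⟨max m k, ?_, monotone_spanningSets μ (le_max_right m k) hk⟩
    exact hm.trans (by exact_mod_cast le_max_left m k)

theorem sqrtRN_act {X : Type*} [MeasurableSpace X] [MeasurableSingletonClass X]
    (T : TransferOperator X) {μ κ : Measure X} [SigmaFinite μ] [SigmaFinite κ] (h : μ ≪ κ) :
    sqrtRN (T.act μ) (T.act κ) =ᵐ[T.act κ] fun x => sqrtRN μ κ (T.σ x) := by
  have e := T.act_withDensity κ (Measure.measurable_rnDeriv μ κ)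
  rw [Measure.withDensity_rnDeriv_eq _ _ h] at e
  have h2 := Measure.rnDeriv_withDensity (T.act κ)
    ((Measure.measurable_rnDeriv μ κ).comp T.measurable_σ)
  rw [← e] at h2
  filter_upwards [h2] with x hx
  simp [sqrtRN, hx]

/-- `v = (f ∘ σ) √d(μR)` for a representation `u = f √dμ` with `f ∘ σ ∈ L²(μR)`. -/
def HatRel {X : Type*} [MeasurableSpace X] [MeasurableSingletonClass X]
    (T : TransferOperator X) (u v : UHilbert X) : Prop :=
  ∃ (μ : Measure X) (_ : SigmaFinite μ) (f : X → ℝ) (hf : MemLp f 2 μ)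
    (hσ : MemLp (f ∘ T.σ) 2 (T.act μ)), u = cls f μ hf ∧ v = cls (f ∘ T.σ) (T.act μ) hσ

theorem act_mul_ae {X : Type*} [MeasurableSpace X] [MeasurableSingletonClass X]
    (T : TransferOperator X) {μ κ : Measure X} [SigmaFinite μ] [SigmaFinite κ] (h : μ ≪ κ)
    (f : X → ℝ) : (fun x => (f ∘ T.σ) x * sqrtRN (T.act μ) (T.act κ) x) =ᵐ[T.act κ]
      (fun x => f x * sqrtRN μ κ x) ∘ T.σ := by
  filter_upwards [T.sqrtRN_act h] with x hx
  simp [hx]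

theorem memLp_act_change {X : Type*} [MeasurableSpace X] [MeasurableSingletonClass X]
    (T : TransferOperator X) {μ κ : Measure X} [SigmaFinite μ] [SigmaFinite κ] (h : μ ≪ κ)
    {f : X → ℝ} (hf : MemLp f 2 μ) :
    MemLp ((fun x => f x * sqrtRN μ κ x) ∘ T.σ) 2 (T.act κ) ↔
      MemLp (f ∘ T.σ) 2 (T.act μ) := by
  rw [← memLp_mul_sqrtRN_iff (T.act_mono_ac h) (hf.1.comp_quasiMeasurePreserving (T.quasi μ))]
  exact memLp_congr_ae (T.act_mul_ae h f).symm

theorem cls_act_change {X : Type*} [MeasurableSpace X] [MeasurableSingletonClass X]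
    (T : TransferOperator X) {μ κ : Measure X} [SigmaFinite μ] [SigmaFinite κ] (h : μ ≪ κ)
    {f : X → ℝ} (hσ : MemLp (f ∘ T.σ) 2 (T.act μ))
    (hσ' : MemLp ((fun x => f x * sqrtRN μ κ x) ∘ T.σ) 2 (T.act κ)) :
    cls (f ∘ T.σ) (T.act μ) hσ = cls ((fun x => f x * sqrtRN μ κ x) ∘ T.σ) (T.act κ) hσ' := by
  rw [cls_change (T.act_mono_ac h), cls_eq_iff]
  exact T.act_mul_ae h f

theorem HatRel.exists {X : Type*} [MeasurableSpace X] [MeasurableSingletonClass X]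
    {T : TransferOperator X} {u v : UHilbert X} (h : T.HatRel u v) :
    ∃ (μ : Measure X) (_ : SigmaFinite μ), ∀ (κ : Measure X) [SigmaFinite κ], μ ≪ κ →
      ∃ (f : X → ℝ) (hf : MemLp f 2 κ) (hσ : MemLp (f ∘ T.σ) 2 (T.act κ)),
        u = cls f κ hf ∧ v = cls (f ∘ T.σ) (T.act κ) hσ := by
  obtain ⟨μ, _, f, hf, hσ, rfl, rfl⟩ := h
  refine ⟨μ, inferInstance, fun κ _ hκ => ?_⟩
  have h2 := (T.memLp_act_change hκ hf).2 hσ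
  exact ⟨_, _, h2, cls_change hκ hf, T.cls_act_change hκ hσ h2⟩

theorem HatRel.exists₂ {X : Type*} [MeasurableSpace X] [MeasurableSingletonClass X]
    {T : TransferOperator X} {u v u' v' : UHilbert X} (h : T.HatRel u v) (h' : T.HatRel u' v') :
    ∃ (κ : Measure X) (_ : SigmaFinite κ) (f g : X → ℝ) (hf : MemLp f 2 κ) (hg : MemLp g 2 κ)
      (hfσ : MemLp (f ∘ T.σ) 2 (T.act κ)) (hgσ : MemLp (g ∘ T.σ) 2 (T.act κ)),
        u = cls f κ hf ∧ v = cls (f ∘ T.σ) (T.act κ) hfσ ∧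
        u' = cls g κ hg ∧ v' = cls (g ∘ T.σ) (T.act κ) hgσ := by
  obtain ⟨μ, _, h⟩ := h.exists
  obtain ⟨ν, _, h'⟩ := h'.exists
  obtain ⟨f, hf, hfσ, rfl, rfl⟩ := h _ (ac_left μ ν)
  obtain ⟨g, hg, hgσ, rfl, rfl⟩ := h' _ (ac_right μ ν)
  exact ⟨μ + ν, inferInstance, f, g, hf, hg, hfσ, hgσ, rfl, rfl, rfl, rfl⟩

theorem HatRel.unique {X : Type*} [MeasurableSpace X] [MeasurableSingletonClass X]
    {T : TransferOperator X} {u v v' : UHilbert X} (h : T.HatRel u v) (h' : T.HatRel u v') :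
    v = v' := by
  obtain ⟨κ, _, f, g, hf, hg, hfσ, hgσ, rfl, rfl, e, rfl⟩ := h.exists₂ h'
  rw [cls_eq_iff] at e ⊢
  exact (T.quasi κ).ae_eq e

theorem HatRel.add {X : Type*} [MeasurableSpace X] [MeasurableSingletonClass X]
    {T : TransferOperator X} {u v u' v' : UHilbert X} (h : T.HatRel u v) (h' : T.HatRel u' v') :
    T.HatRel (u + u') (v + v') := by
  obtain ⟨κ, _, f, g, hf, hg, hfσ, hgσ, rfl, rfl, rfl, rfl⟩ := h.exists₂ h'
  exact ⟨κ, inferInstance, fun x => f x + g x, hf.add hg, hfσ.add hgσ, cls_add hf hg,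
    cls_add hfσ hgσ⟩

theorem HatRel.smul {X : Type*} [MeasurableSpace X] [MeasurableSingletonClass X]
    {T : TransferOperator X} {u v : UHilbert X} (c : ℝ) (h : T.HatRel u v) :
    T.HatRel (c • u) (c • v) := by
  obtain ⟨κ, _, f, hf, hfσ, rfl, rfl⟩ := h
  exact ⟨κ, inferInstance, fun x => c * f x, hf.const_mul c, hfσ.const_mul c, cls_smul c hf,
    cls_smul c hfσ⟩

theorem HatRel.zero {X : Type*} [MeasurableSpace X] [MeasurableSingletonClass X]
    (T : TransferOperator X) : T.HatRel 0 0 :=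
  ⟨0, inferInstance, fun _ => 0, MemLp.zero', MemLp.zero', zero_eq_cls 0, zero_eq_cls _⟩

/-- The operator `Ŝ (f √dμ) = (f ∘ σ) √d(μR)` of `ℋ(X)`. Its domain consists of all
classes `f √dμ` with `f ∘ σ ∈ L²(μR)`. -/
def hatS {X : Type*} [MeasurableSpace X] [MeasurableSingletonClass X]
    (T : TransferOperator X) : UHilbert X →ₗ.[ℝ] UHilbert X where
  domain :=
    { carrier := {u | ∃ v, T.HatRel u v}
      add_mem' := fun ⟨_, h⟩ ⟨_, h'⟩ => ⟨_, h.add h'⟩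
      zero_mem' := ⟨_, HatRel.zero T⟩
      smul_mem' := fun c _ ⟨_, h⟩ => ⟨_, h.smul c⟩ }
  toFun :=
    { toFun := fun u => u.2.choose
      map_add' := fun u u' =>
        (u + u').2.choose_spec.unique (u.2.choose_spec.add u'.2.choose_spec)
      map_smul' := fun c u => (c • u).2.choose_spec.unique (u.2.choose_spec.smul c) }

theorem mem_domain_hatS {X : Type*} [MeasurableSpace X] [MeasurableSingletonClass X]
    (T : TransferOperator X) {μ : Measure X} [SigmaFinite μ] {f : X → ℝ} (hf : MemLp f 2 μ) :
    cls f μ hf ∈ T.hatS.domain ↔ MemLp (f ∘ T.σ) 2 (T.act μ) := by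
  constructor
  · rintro ⟨v, h⟩
    obtain ⟨ν, _, h⟩ := h.exists
    obtain ⟨g, hg, hgσ, e, -⟩ := h _ (ac_right μ ν)
    rw [cls_change (ac_left μ ν), cls_eq_iff] at e
    rw [← T.memLp_act_change (ac_left μ ν) hf]
    exact (memLp_congr_ae ((T.quasi (μ + ν)).ae_eq e)).2 hgσ
  · intro h
    exact ⟨_, μ, inferInstance, f, hf, h, rfl, rfl⟩

theorem hatS_cls {X : Type*} [MeasurableSpace X] [MeasurableSingletonClass X]
    (T : TransferOperator X) {μ : Measure X} [SigmaFinite μ] {f : X → ℝ} (hf : MemLp f 2 μ)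
    (hσ : MemLp (f ∘ T.σ) 2 (T.act μ)) :
    T.hatS ⟨cls f μ hf, (T.mem_domain_hatS hf).2 hσ⟩ = cls (f ∘ T.σ) (T.act μ) hσ :=
  HatRel.unique (T := T) (Exists.choose_spec ((T.mem_domain_hatS hf).2 hσ))
    ⟨μ, inferInstance, f, hf, hσ, rfl, rfl⟩

/-- The set `𝓛(R)` of all σ-finite measures `μ` with `μR ≪ μ`. -/
def LSet {X : Type*} [MeasurableSpace X] (T : TransferOperator X) : Set (Measure X) :=
  {μ | SigmaFinite μ ∧ T.act μ ≪ μ}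

end TransferOperator

end

end UniversalHilbert

/-! The pull-out property says that `R(φ ∘ σ) = φ R(1)`, so `σ` pushes `λR` forward to `R(1) λ`, and
`‖Ŝ (f √dλ)‖² = ∫ f² R(1) dλ`. If `R(1) = 1` this is `‖f √dλ‖²`; conversely, at a unit point mass
`λ = δ_x` and `f = 1` it is `R(1)(x)`, which an isometry forces to be `1`. The invariance of `ℋ(λ)`
holds because `(f ∘ σ) √d(λR) = (f ∘ σ) √(d(λR)/dλ) √dλ` when `λR ≪ λ`. -/

namespace UniversalHilbert

variable {X : Type*} [MeasurableSpace X]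

theorem norm_cls_sq {μ : Measure X} [SigmaFinite μ] {f : X → ℝ} (hf : MemLp f 2 μ) :
    ‖cls f μ hf‖ ^ 2 = ∫ x, f x ^ 2 ∂μ := by
  rw [← real_inner_self_eq_norm_sq]
  exact (cls_inner hf hf).trans (by simp only [pow_two])

namespace TransferOperator

variable (T : TransferOperator X)

theorem R_one_nonneg (x : X) : 0 ≤ (T.R T.one).1 x :=
  T.nonneg T.one (fun _ => zero_le_one) x

theorem measurable_R_one : Measurable (T.R T.one).1 :=
  (T.R T.one).2

theorem ker_univ (x : X) : T.ker x Set.univ = ENNReal.ofReal ((T.R T.one).1 x) := by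
  have chi_univ : T.chi Set.univ MeasurableSet.univ = T.one :=
    Subtype.ext (Set.indicator_univ 1)
  rw [T.ker_apply x MeasurableSet.univ, chi_univ]

variable [MeasurableSingletonClass X]

theorem measurePreserving_act (μ : Measure X) :
    MeasurePreserving T.σ (T.act μ)
      (μ.withDensity fun x => ENNReal.ofReal ((T.R T.one).1 x)) := by
  refine ⟨T.measurable_σ, Measure.ext_of_lintegral _ fun φ hφ => ?_⟩
  calc ∫⁻ x, φ x ∂(T.act μ).map T.σ
      = ∫⁻ y, φ (T.σ y) * 1 ∂T.act μ := by simp only [lintegral_map hφ T.measurable_σ, mul_one]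
    _ = ∫⁻ x, φ x * ∫⁻ _, 1 ∂T.ker x ∂μ := T.lintegral_act_mul μ hφ measurable_const
    _ = ∫⁻ x, ENNReal.ofReal ((T.R T.one).1 x) * φ x ∂μ := by
      simp only [lintegral_one, T.ker_univ, mul_comm]
    _ = ∫⁻ x, φ x ∂μ.withDensity fun x => ENNReal.ofReal ((T.R T.one).1 x) :=
      (lintegral_withDensity_eq_lintegral_mul μ T.measurable_R_one.ennreal_ofReal hφ).symm

variable {μ : Measure X} [SigmaFinite μ] {f : X → ℝ}

theorem cls_mem_domain_hatS_iff (hf : MemLp f 2 μ) :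
    cls f μ hf ∈ T.hatS.domain ↔
      MemLp f 2 (μ.withDensity fun x => ENNReal.ofReal ((T.R T.one).1 x)) := by
  have map_act := (T.measurePreserving_act μ).map_eq
  have f_aesm : AEStronglyMeasurable f ((T.act μ).map T.σ) := by
    rw [map_act]
    exact hf.1.mono_ac (withDensity_absolutelyContinuous μ _)
  rw [T.mem_domain_hatS hf, ← memLp_map_measure_iff f_aesm T.measurable_σ.aemeasurable, map_act]

theorem norm_hatS_cls_sq (hf : MemLp f 2 μ) (hd : cls f μ hf ∈ T.hatS.domain) :
    ‖T.hatS ⟨cls f μ hf, hd⟩‖ ^ 2 = ∫ x, (T.R T.one).1 x * f x ^ 2 ∂μ := by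
  have hσ : MemLp (f ∘ T.σ) 2 (T.act μ) := (T.mem_domain_hatS hf).1 hd
  have map_act := (T.measurePreserving_act μ).map_eq
  have sq_aesm : AEStronglyMeasurable (fun x => f x ^ 2) ((T.act μ).map T.σ) := by
    rw [map_act]
    exact (hf.1.pow 2).mono_ac (withDensity_absolutelyContinuous μ _)
  calc ‖T.hatS ⟨cls f μ hf, hd⟩‖ ^ 2
      = ∫ y, f (T.σ y) ^ 2 ∂T.act μ := by rw [T.hatS_cls hf hσ, norm_cls_sq hσ]; rfl
    _ = ∫ x, f x ^ 2 ∂(T.act μ).map T.σ :=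
      (integral_map T.measurable_σ.aemeasurable sq_aesm).symm
    _ = ∫ x, (ENNReal.ofReal ((T.R T.one).1 x)).toReal • f x ^ 2 ∂μ := by
      rw [map_act, integral_withDensity_eq_integral_toReal_smul
        T.measurable_R_one.ennreal_ofReal (ae_of_all _ fun _ => ENNReal.ofReal_lt_top)]
    _ = ∫ x, (T.R T.one).1 x * f x ^ 2 ∂μ := by
      simp only [ENNReal.toReal_ofReal (T.R_one_nonneg _), smul_eq_mul]

theorem domain_hatS_eq_top (h : (T.R T.one).1 = 1) : T.hatS.domain = ⊤ := by
  refine eq_top_iff.2 fun u _ => ?_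
  obtain ⟨μ, _, f, -, hf, -, rfl, -⟩ := exists_cls₂ u u
  simpa only [cls_mem_domain_hatS_iff, h, Pi.one_apply, ENNReal.ofReal_one,
    ← Pi.one_def, withDensity_one] using hf

theorem isometry_hatS_iff_norm : Isometry T.hatS ↔ ∀ u : T.hatS.domain, ‖T.hatS u‖ = ‖u‖ :=
  AddMonoidHomClass.isometry_iff_norm T.hatS.toFun

theorem isometry_hatS (h : (T.R T.one).1 = 1) : Isometry T.hatS := by
  refine T.isometry_hatS_iff_norm.2 fun ⟨u, hu⟩ => ?_
  obtain ⟨μ, _, f, -, hf, -, rfl, -⟩ := exists_cls₂ u u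
  rw [Submodule.coe_norm, ← sq_eq_sq₀ (norm_nonneg _) (norm_nonneg _),
    T.norm_hatS_cls_sq hf hu, norm_cls_sq hf]
  simp only [h, Pi.one_apply, one_mul]

theorem R_one_eq_one_of_isometry_hatS (h : Isometry T.hatS) : (T.R T.one).1 = 1 := by
  funext x
  have : IsFiniteMeasure
      ((Measure.dirac x).withDensity fun y => ENNReal.ofReal ((T.R T.one).1 y)) :=
    isFiniteMeasure_withDensity_ofReal (integrable_dirac (by simp)).2
  have one_memLp : MemLp (1 : X → ℝ) 2 (Measure.dirac x) := memLp_const 1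
  have one_mem : cls 1 (Measure.dirac x) one_memLp ∈ T.hatS.domain :=
    (T.cls_mem_domain_hatS_iff one_memLp).2 (memLp_const 1)
  have norm_eq := T.isometry_hatS_iff_norm.1 h ⟨_, one_mem⟩
  calc (T.R T.one).1 x
      = ‖T.hatS ⟨_, one_mem⟩‖ ^ 2 := by simp [T.norm_hatS_cls_sq one_memLp one_mem]
    _ = ‖cls 1 (Measure.dirac x) one_memLp‖ ^ 2 := by rw [norm_eq, Submodule.coe_norm]
    _ = 1 := by simp [norm_cls_sq]

theorem hatS_mem_subspaceOf {ν : Measure X} [SigmaFinite ν] (h : T.act μ ≪ ν)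
    (u : T.hatS.domain) (hu : (u : UHilbert X) ∈ subspaceOf μ) : T.hatS u ∈ subspaceOf ν := by
  obtain ⟨_, hd⟩ := u
  obtain ⟨f, rfl⟩ := hu
  have hσ : MemLp (f ∘ T.σ) 2 (T.act μ) := (T.mem_domain_hatS (Lp.memLp f)).1 hd
  have hatS_eq : T.hatS ⟨_, hd⟩ = cls (f ∘ T.σ) (T.act μ) hσ := T.hatS_cls _ hσ
  rw [hatS_eq, cls_change h hσ]
  exact cls_mem_subspaceOf _

end TransferOperator

end UniversalHilbert

theorem mainTheorem7_general {X : Type*} [MeasurableSpace X] [MeasurableSingletonClass X]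
    (T : UniversalHilbert.TransferOperator X) :
    ((Isometry T.hatS ↔ (T.R T.one).1 = 1) ∧ ((T.R T.one).1 = 1 → T.hatS.domain = ⊤)) ∧
      ∀ (μ : Measure X) [SigmaFinite μ], μ ∈ T.LSet →
        ∀ u : T.hatS.domain, (u : UniversalHilbert.UHilbert X) ∈ UniversalHilbert.subspaceOf μ →
          T.hatS u ∈ UniversalHilbert.subspaceOf μ :=
  ⟨⟨⟨T.R_one_eq_one_of_isometry_hatS, T.isometry_hatS⟩, T.domain_hatS_eq_top⟩,
    fun _ _ hμ => T.hatS_mem_subspaceOf hμ.2⟩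

theorem mainTheorem7 {X : Type*} [MeasurableSpace X] [StandardBorelSpace X]
    (T : UniversalHilbert.TransferOperator X) :
    ((Isometry T.hatS ↔ (T.R T.one).1 = 1) ∧ ((T.R T.one).1 = 1 → T.hatS.domain = ⊤)) ∧
      ∀ (μ : Measure X) [SigmaFinite μ], μ ∈ T.LSet →
        ∀ u : T.hatS.domain, (u : UniversalHilbert.UHilbert X) ∈ UniversalHilbert.subspaceOf μ →
          T.hatS u ∈ UniversalHilbert.subspaceOf μ :=
  mainTheorem7_general T
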